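/- A Pisot number is a real algebraic integer $\beta>1$ all of whose conjugates over $\mathbb{Q}$ other than $\beta$ have absolute value less than $1$. A Salem number is a real algebraic integer $\beta>1$ all of whose conjugates over $\mathbb{Q}$ other than $\beta$ have absolute value at most $1$, at least one of them having absolute value exactly $1$. For real $y>0$ and real $X$ with $0\le X<1$ put $$\xi(y;X)=1+\sum_{m=1}^{\infty}X^{\lfloor \exp((\log m)^{1+y})\rfloor}=1+\sum_{m=1}^{\infty}X^{\lfloor m^{(\log m)^y}\rfloor}.$$ **Theorem.** Let $\beta$ be a Pisot or Salem number. Then the continuum set $$\{\xi(y;\beta^{-1})\mid y\in\mathbb{R},\ y\ge 1\}$$ is algebraically independent over $\mathbb{Q}$; more precisely, for any finitely many distinct real numbers $y_1,\dots,y_r\ge 1$, the numbers $\xi(y_1;\beta^{-1}),\dots,\xi(y_r;\beta^{-1})$ are algebraically independent over $\mathbb{Q}$ (in particular they are pairwise distinct). -/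

import Mathlib

/-- `β` is a Pisot number: a real algebraic integer greater than `1` all of whose conjugates
other than `β` itself have absolute value less than `1`. -/
def IsPisotNumber (β : ℝ) : Prop :=
  IsIntegral ℤ β ∧ 1 < β ∧
    ∀ z : ℂ, Polynomial.aeval z (minpoly ℚ β) = 0 → z ≠ (β : ℂ) → ‖z‖ < 1

/-- `β` is a Salem number: a real algebraic integer greater than `1` all of whose conjugates
other than `β` itself have absolute value at most `1`, at least one of them having absolute
value exactly `1`. -/
def IsSalemNumber (β : ℝ) : Prop :=
  IsIntegral ℤ β ∧ 1 < β ∧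
    (∀ z : ℂ, Polynomial.aeval z (minpoly ℚ β) = 0 → z ≠ (β : ℂ) → ‖z‖ ≤ 1) ∧
    ∃ z : ℂ, Polynomial.aeval z (minpoly ℚ β) = 0 ∧ ‖z‖ = 1

/-- `φ(y; R) = exp ((log R) ^ (1 + y))`, for `y > 0` and `R ≥ 1`. -/
noncomputable def phiGrowth (y R : ℝ) : ℝ :=
  Real.exp (Real.log R ^ (1 + y))

/-- `φ(y; R) = R ^ ((log R) ^ y)`. -/
theorem phiGrowth_eq_rpow {y R : ℝ} (hy : 0 < y) (hR : 1 ≤ R) :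
    phiGrowth y R = R ^ (Real.log R ^ y) := by
  have hlog : 0 ≤ Real.log R := Real.log_nonneg hR
  have hpos : 0 < R := by linarith
  rw [phiGrowth, Real.rpow_def_of_pos hpos,
    Real.rpow_add_of_nonneg hlog zero_le_one hy.le, Real.rpow_one]

/-- `ξ(y; X) = 1 + ∑_{m ≥ 1} X ^ ⌊φ(y; m)⌋`. -/
noncomputable def xiSeries (y X : ℝ) : ℝ :=
  1 + ∑' m : ℕ, X ^ ⌊phiGrowth y ((m : ℝ) + 1)⌋₊

/-- The series defining `ξ(y; X)` converges for `y > 0` and `0 ≤ X < 1`. -/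
theorem summable_xiSeries {y X : ℝ} (hy : 0 < y) (h0 : 0 ≤ X) (h1 : X < 1) :
    Summable fun m : ℕ => X ^ ⌊phiGrowth y ((m : ℝ) + 1)⌋₊ := by
  rw [← summable_nat_add_iff 2]
  refine Summable.of_nonneg_of_le (fun m => pow_nonneg h0 _) (fun m => ?_)
    (summable_geometric_of_lt_one h0 h1)
  refine pow_le_pow_of_le_one h0 h1.le (Nat.le_floor ?_)
  have hm : (0 : ℝ) ≤ (m : ℝ) := Nat.cast_nonneg m
  have hR : (3 : ℝ) ≤ ((m + 2 : ℕ) : ℝ) + 1 := by push_cast; linarith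
  have hpos : (0 : ℝ) < ((m + 2 : ℕ) : ℝ) + 1 := by linarith
  have hlog : 1 ≤ Real.log (((m + 2 : ℕ) : ℝ) + 1) := by
    rw [Real.le_log_iff_exp_le hpos]
    linarith [Real.exp_one_lt_d9]
  have hle : ((m + 2 : ℕ) : ℝ) + 1 ≤ phiGrowth y (((m + 2 : ℕ) : ℝ) + 1) := by
    rw [phiGrowth, ← Real.log_le_iff_le_exp hpos]
    exact Real.self_le_rpow_of_one_le hlog (by linarith)
  refine le_trans ?_ hle
  push_cast
  linarith

/-! Suppose an integer polynomial `P ≠ 0` vanishes at the numbers `ξ(y; β⁻¹)`. Substituting the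
power series of the `ξ(y; X)` into `P` gives integers `c n` of polynomial growth with `∑ c n * β⁻¹ ^
n = 0`.

Arithmetic: if `c` vanishes on a block of length `M` starting at `R ≤ M ^ 2`, then `β ^ R` times the
partial sum up to `R` is an algebraic integer that is exponentially small in `M`, while its other
conjugates are polynomially bounded because those of `β` lie in the closed unit disc. For large `M`
its norm has absolute value below `1`, so the partial sum is exactly `0`
(`eventually_partial_sum_eq_zero`). Hence the sum of `c` between any two such gaps vanishes.

Counting: up to constant factors, at most `exp (∑ k y * t ^ (1 + y)⁻¹)` exponents up to `exp t`
occur in the monomial `k`. Let `g` be the lexicographically largest monomial of `P`, small `y` being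
compared first; its weight beats that of every other monomial. Its support contains about that many
well separated exponents (`exists_separated_monomialSeries`), hence more than all other monomials
have exponents together. So some exponent of `g` lies between two nearby gaps with no other monomial
in between. There `c` is a nonzero constant times nonnegative coefficients, one of them positive, so
the block sum is nonzero: a contradiction (`card_le_of_partial_sum_eq_zero`). -/

section

open Filter Topology Finset

/-! ### Arithmetic of `β`: long gaps force vanishing partial sums. -/

/-- The norm of `p(β)` from `ℚ(β)` is a nonzero integer. Every embedding other than the identity
sends `β` into the closed unit disc, so it contributes a factor at most `B`; `d` counts these
embeddings. -/
theorem exists_one_le_abs_aeval_mul_pow {β : ℝ} (hint : IsIntegral ℤ β)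
    (hconj : ∀ z : ℂ, Polynomial.aeval z (minpoly ℚ β) = 0 → z ≠ (β : ℂ) → ‖z‖ ≤ 1) :
    ∃ d : ℕ, ∀ p : Polynomial ℤ, Polynomial.aeval β p ≠ 0 → ∀ B : ℝ,
      (∀ z : ℂ, ‖z‖ ≤ 1 → ‖Polynomial.aeval z p‖ ≤ B) →
        1 ≤ |Polynomial.aeval β p| * B ^ d := by
  classical
  have hintQ : IsIntegral ℚ β := hint.tower_top
  have : FiniteDimensional ℚ (IntermediateField.adjoin ℚ {β}) :=
    IntermediateField.adjoin.finiteDimensional hintQ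
  let K := IntermediateField.adjoin ℚ {β}
  let γ : K := IntermediateField.AdjoinSimple.gen ℚ β
  have hγ : (γ : ℝ) = β := IntermediateField.AdjoinSimple.coe_gen ℚ β
  let σ₀ : K →ₐ[ℚ] ℂ := (Complex.ofRealAm.restrictScalars ℚ).comp K.val
  have hσ₀ : σ₀ γ = (β : ℂ) := by
    change ((γ : ℝ) : ℂ) = β
    rw [hγ]
  refine ⟨(univ.erase σ₀).card, fun p hp B hB => ?_⟩
  have hval : ((Polynomial.aeval γ p : K) : ℝ) = Polynomial.aeval β p := by
    have := Polynomial.aeval_algHom_apply (K.val.restrictScalars ℤ) γ p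
    rw [← hγ]
    exact this.symm
  have hx : (Polynomial.aeval γ p : K) ≠ 0 := by
    intro h
    apply hp
    rw [← hval, h]
    rfl
  have hσ : ∀ σ : K →ₐ[ℚ] ℂ, σ (Polynomial.aeval γ p) = Polynomial.aeval (σ γ) p := fun σ =>
    (Polynomial.aeval_algHom_apply (σ.restrictScalars ℤ) γ p).symm
  have hγint : IsIntegral ℤ γ := by
    have : IsIntegral ℤ (K.val.restrictScalars ℤ γ) := by
      change IsIntegral ℤ (γ : ℝ)
      rwa [hγ]
    exact (isIntegral_algHom_iff (K.val.restrictScalars ℤ) Subtype.val_injective).1 this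
  have hxint : IsIntegral ℤ (Polynomial.aeval γ p : K) := by
    rw [Polynomial.aeval_eq_sum_range]
    exact IsIntegral.sum _ fun i _ => (hγint.pow i).smul _
  obtain ⟨n, hn⟩ := IsIntegrallyClosed.isIntegral_iff.1 (Algebra.isIntegral_norm ℚ hxint)
  have hn0 : n ≠ 0 := by
    rintro rfl
    have : Algebra.norm ℚ (Polynomial.aeval γ p : K) = 0 := by rw [← hn]; simp
    exact hx (Algebra.norm_eq_zero_iff.1 this)
  have hprod := Algebra.norm_eq_prod_embeddings ℚ ℂ (Polynomial.aeval γ p : K)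
  rw [← hn, ← Finset.mul_prod_erase _ _ (Finset.mem_univ σ₀)] at hprod
  have hnorm := congrArg norm hprod
  have h1 : (1 : ℝ) ≤ ‖(algebraMap ℚ ℂ) ((algebraMap ℤ ℚ) n)‖ := by
    simp only [eq_intCast, map_intCast]
    rw [Complex.norm_intCast]
    exact_mod_cast Int.one_le_abs hn0
  rw [hnorm, norm_mul, norm_prod] at h1
  have h0 : ‖σ₀ (Polynomial.aeval γ p)‖ = |Polynomial.aeval β p| := by
    change ‖(((Polynomial.aeval γ p : K) : ℝ) : ℂ)‖ = _
    rw [hval, Complex.norm_real, Real.norm_eq_abs]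
  rw [h0] at h1
  refine h1.trans (mul_le_mul_of_nonneg_left ?_ (abs_nonneg _))
  rw [← Finset.prod_const]
  refine Finset.prod_le_prod (fun _ _ => norm_nonneg _) fun σ hσmem => ?_
  rw [hσ]
  apply hB
  apply hconj
  · have hmin : Polynomial.aeval γ (minpoly ℚ β) = 0 := by
      apply Subtype.val_injective
      have := Polynomial.aeval_algHom_apply K.val γ (minpoly ℚ β)
      have h2 : K.val γ = β := hγ
      rw [h2, minpoly.aeval] at this
      exact this.symm
    rw [Polynomial.aeval_algHom_apply, hmin, map_zero]
  · intro h
    apply (Finset.mem_erase.1 hσmem).1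
    refine IntermediateField.adjoin_algHom_ext ℚ fun x hx => ?_
    obtain rfl : x = β := hx
    exact h.trans hσ₀.symm

theorem eventually_partial_sum_eq_zero {β : ℝ} (hint : IsIntegral ℤ β) (h1 : 1 < β)
    (hconj : ∀ z : ℂ, Polynomial.aeval z (minpoly ℚ β) = 0 → z ≠ (β : ℂ) → ‖z‖ ≤ 1)
    {c : ℕ → ℤ} {K E : ℕ} (hc : ∀ n, |(c n : ℝ)| ≤ K * ((n : ℝ) + 1) ^ E)
    (hsum : HasSum (fun n => (c n : ℝ) * β⁻¹ ^ n) 0) :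
    ∀ᶠ M : ℕ in atTop, ∀ R ≤ M ^ 2, (∀ n, R ≤ n → n < R + M → c n = 0) →
      ∑ n ∈ range R, (c n : ℝ) * β⁻¹ ^ n = 0 := by
  obtain ⟨d, hd⟩ := exists_one_le_abs_aeval_mul_pow hint hconj
  have hβ0 : 0 < β := by linarith
  set x := β⁻¹ with hx
  have hx0 : 0 < x := inv_pos.2 hβ0
  have hx1 : x < 1 := inv_lt_one_of_one_lt₀ h1
  have hxβ : x * β = 1 := inv_mul_cancel₀ hβ0.ne'
  have hS : Summable fun j : ℕ => ((j : ℝ) + 1) ^ E * x ^ j := by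
    have h := summable_pow_mul_geometric_of_norm_lt_one E (r := x)
      (by rwa [Real.norm_of_nonneg hx0.le])
    have h' := ((summable_nat_add_iff 1).2 h).mul_right x⁻¹
    refine h'.congr fun j => ?_
    push_cast
    rw [pow_succ]
    field_simp
  set S := ∑' j : ℕ, ((j : ℝ) + 1) ^ E * x ^ j with hSdef
  have hS0 : 0 ≤ S := tsum_nonneg fun j => by positivity
  -- This is the final bound for `|p(β)| * B ^ d`: since `R ≤ M ^ 2`, all polynomial factors are
  -- powers of `M`, and they lose against `x ^ M`.
  have htend : Tendsto (fun M : ℕ => (K * 3 ^ E * S * (K * 2 ^ (E + 1)) ^ d) *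
      ((M : ℝ) ^ (2 * E + 2 * (E + 1) * d) * x ^ M)) atTop (𝓝 0) := by
    have := tendsto_pow_const_mul_const_pow_of_abs_lt_one (2 * E + 2 * (E + 1) * d) (r := x)
      (by rwa [abs_of_pos hx0])
    simpa using this.const_mul (K * 3 ^ E * S * (K * 2 ^ (E + 1)) ^ d)
  filter_upwards [htend.eventually (gt_mem_nhds one_pos), eventually_ge_atTop 1] with M hM hM1
    R hR hgap
  have hM1' : (1 : ℝ) ≤ M := by exact_mod_cast hM1
  have hR' : (R : ℝ) ≤ (M : ℝ) ^ 2 := by exact_mod_cast hR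
  by_contra hne
  let p : Polynomial ℤ := ∑ n ∈ range R, Polynomial.C (c n) * Polynomial.X ^ (R - n)
  have hp : Polynomial.aeval β p = β ^ R * ∑ n ∈ range R, (c n : ℝ) * x ^ n := by
    simp only [p, map_sum, map_mul, Polynomial.aeval_C, map_pow, Polynomial.aeval_X,
      Finset.mul_sum]
    refine Finset.sum_congr rfl fun n hn => ?_
    have hnR : n ≤ R := (Finset.mem_range.1 hn).le
    have : β ^ R * x ^ n = β ^ (R - n) := by
      conv_lhs => rw [← Nat.sub_add_cancel hnR, pow_add, mul_assoc, ← mul_pow, mul_comm β x, hxβ]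
      simp
    rw [← this]
    simp only [eq_intCast]
    ring
  have hp0 : Polynomial.aeval β p ≠ 0 := by
    rw [hp]
    exact mul_ne_zero (pow_pos hβ0 _).ne' hne
  have hB : ∀ z : ℂ, ‖z‖ ≤ 1 → ‖Polynomial.aeval z p‖ ≤ K * ((R : ℝ) + 1) ^ (E + 1) := by
    intro z hz
    simp only [p, map_sum, map_mul, Polynomial.aeval_C, map_pow, Polynomial.aeval_X]
    calc _ ≤ ∑ n ∈ range R, K * ((R : ℝ) + 1) ^ E := by
          refine norm_sum_le_of_le _ fun n hn => ?_
          rw [norm_mul, norm_pow, eq_intCast, Complex.norm_intCast]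
          have hnR : (n : ℝ) ≤ R := by exact_mod_cast (Finset.mem_range.1 hn).le
          calc _ ≤ |(c n : ℝ)| * 1 := by
                gcongr
                exact pow_le_one₀ (norm_nonneg _) hz
            _ ≤ K * ((n : ℝ) + 1) ^ E := by rw [mul_one]; exact hc n
            _ ≤ _ := by gcongr
      _ = R * (K * ((R : ℝ) + 1) ^ E) := by simp
      _ ≤ (R + 1) * (K * ((R : ℝ) + 1) ^ E) := by gcongr; linarith
      _ = _ := by ring
  have key := hd p hp0 _ hB
  -- The full sum is `0` and the block after `R` is empty, so `p(β)` is minus the tail from `R + M`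
  -- on, scaled by `β ^ R`.
  have htail : |Polynomial.aeval β p| ≤ K * ((R : ℝ) + M + 1) ^ E * x ^ M * S := by
    have hs2 := hsum.summable
    have hsplit := hs2.sum_add_tsum_nat_add (R + M)
    rw [hsum.tsum_eq, Finset.sum_range_add] at hsplit
    have hz : ∑ j ∈ range M, (c (R + j) : ℝ) * x ^ (R + j) = 0 := by
      refine Finset.sum_eq_zero fun j hj => ?_
      rw [hgap (R + j) (by omega) (by have := Finset.mem_range.1 hj; omega)]
      simp
    rw [hz, add_zero] at hsplit
    have heq : Polynomial.aeval β p =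
        -∑' j : ℕ, (c (j + (R + M)) : ℝ) * (x ^ j * x ^ M) := by
      rw [hp, eq_neg_of_add_eq_zero_left hsplit, mul_neg, ← tsum_mul_left]
      congr 1
      refine tsum_congr fun j => ?_
      have : β ^ R * x ^ (j + (R + M)) = x ^ j * x ^ M := by
        rw [pow_add, pow_add, show β ^ R * (x ^ j * (x ^ R * x ^ M)) =
          (x ^ R * β ^ R) * (x ^ j * x ^ M) by ring, ← mul_pow, hxβ]
        simp
      rw [← this]
      ring
    have hbd : ∀ j : ℕ, ‖(c (j + (R + M)) : ℝ) * (x ^ j * x ^ M)‖ ≤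
        K * ((R : ℝ) + M + 1) ^ E * x ^ M * (((j : ℝ) + 1) ^ E * x ^ j) := by
      intro j
      rw [norm_mul, Real.norm_of_nonneg (by positivity : 0 ≤ x ^ j * x ^ M), Real.norm_eq_abs]
      have h3 : (((j + (R + M) : ℕ) : ℝ) + 1) ≤ ((R : ℝ) + M + 1) * ((j : ℝ) + 1) := by
        push_cast
        have : (0 : ℝ) ≤ (R + M) * j := by positivity
        nlinarith
      calc _ ≤ (K * (((R : ℝ) + M + 1) * ((j : ℝ) + 1)) ^ E) * (x ^ j * x ^ M) := by
            gcongr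
            refine (hc _).trans ?_
            gcongr
        _ = _ := by rw [mul_pow]; ring
    rw [heq, abs_neg, ← Real.norm_eq_abs]
    refine (tsum_of_norm_bounded (hS.hasSum.mul_left _) hbd)
  have hlast : |Polynomial.aeval β p| * (K * ((R : ℝ) + 1) ^ (E + 1)) ^ d ≤
      (K * 3 ^ E * S * (K * 2 ^ (E + 1)) ^ d) *
      ((M : ℝ) ^ (2 * E + 2 * (E + 1) * d) * x ^ M) := by
    have h3 : (R : ℝ) + M + 1 ≤ 3 * (M : ℝ) ^ 2 := by nlinarith
    have h4 : (R : ℝ) + 1 ≤ 2 * (M : ℝ) ^ 2 := by nlinarith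
    calc _ ≤ (K * (3 * (M : ℝ) ^ 2) ^ E * x ^ M * S) *
          (K * (2 * (M : ℝ) ^ 2) ^ (E + 1)) ^ d := by
          refine mul_le_mul (htail.trans ?_) ?_ (by positivity) (by positivity) <;> gcongr
      _ = _ := by simp only [mul_pow, pow_add, pow_mul]; ring
  linarith

/-! ### Power series with polynomially bounded coefficients and their values. -/

/-- The coefficients of `F` grow at most polynomially. -/
def PolyBounded (F : PowerSeries ℤ) : Prop :=
  ∃ K E : ℕ, ∀ n, |(F.coeff n : ℝ)| ≤ K * ((n : ℝ) + 1) ^ E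

theorem PolyBounded.add {F G : PowerSeries ℤ} (hF : PolyBounded F) (hG : PolyBounded G) :
    PolyBounded (F + G) := by
  obtain ⟨K, E, h⟩ := hF
  obtain ⟨K', E', h'⟩ := hG
  refine ⟨K + K', E + E', fun n => ?_⟩
  have h1 : (1 : ℝ) ≤ (n : ℝ) + 1 := by linarith [(Nat.cast_nonneg n : (0 : ℝ) ≤ n)]
  rw [map_add]
  push_cast
  refine (abs_add_le _ _).trans ?_
  rw [add_mul]
  refine add_le_add ((h n).trans ?_) ((h' n).trans ?_) <;> gcongr <;> omega

theorem PolyBounded.mul {F G : PowerSeries ℤ} (hF : PolyBounded F) (hG : PolyBounded G) :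
    PolyBounded (F * G) := by
  obtain ⟨K, E, h⟩ := hF
  obtain ⟨K', E', h'⟩ := hG
  refine ⟨K * K', E + E' + 1, fun n => ?_⟩
  rw [PowerSeries.coeff_mul]
  push_cast
  calc _ ≤ ∑ p ∈ antidiagonal n, (K * ((n : ℝ) + 1) ^ E) * (K' * ((n : ℝ) + 1) ^ E') := by
        refine (Finset.abs_sum_le_sum_abs _ _).trans (Finset.sum_le_sum fun p hp => ?_)
        rw [abs_mul]
        have hp' := HasAntidiagonal.mem_antidiagonal.1 hp
        have h1 : (p.1 : ℝ) ≤ n := by exact_mod_cast (by omega : p.1 ≤ n)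
        have h2 : (p.2 : ℝ) ≤ n := by exact_mod_cast (by omega : p.2 ≤ n)
        refine mul_le_mul ((h _).trans ?_) ((h' _).trans ?_) (abs_nonneg _) (by positivity) <;>
          gcongr
    _ = _ := by
        rw [Finset.sum_const, Finset.Nat.card_antidiagonal, nsmul_eq_mul]
        push_cast
        ring

theorem polyBounded_C (a : ℤ) : PolyBounded (PowerSeries.C a) := by
  refine ⟨a.natAbs, 0, fun n => ?_⟩
  rw [PowerSeries.coeff_C]
  split_ifs <;> simp

theorem PolyBounded.summable {F : PowerSeries ℤ} (hF : PolyBounded F) {x : ℝ} (h0 : 0 < x)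
    (h1 : x < 1) : Summable fun n => ‖(F.coeff n : ℝ) * x ^ n‖ := by
  obtain ⟨K, E, h⟩ := hF
  have hS := ((summable_nat_add_iff 1).2 (summable_pow_mul_geometric_of_norm_lt_one E (r := x)
      (by rwa [Real.norm_of_nonneg h0.le]))).mul_left (K * x⁻¹)
  refine Summable.of_nonneg_of_le (fun _ => norm_nonneg _) (fun n => ?_) hS
  rw [norm_mul, Real.norm_of_nonneg (pow_pos h0 n).le, Real.norm_eq_abs]
  have : (K : ℝ) * x⁻¹ * (((n + 1 : ℕ) : ℝ) ^ E * x ^ (n + 1)) =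
      K * ((n : ℝ) + 1) ^ E * x ^ n := by
    push_cast
    rw [pow_succ]
    field_simp
  rw [this]
  gcongr
  exact h n

theorem hasSum_coeff_mul {F G : PowerSeries ℤ} (hF : PolyBounded F) (hG : PolyBounded G)
    {x s t : ℝ} (h0 : 0 < x) (h1 : x < 1) (hs : HasSum (fun n => (F.coeff n : ℝ) * x ^ n) s)
    (ht : HasSum (fun n => (G.coeff n : ℝ) * x ^ n) t) :
    HasSum (fun n => ((F * G).coeff n : ℝ) * x ^ n) (s * t) := by
  have hsum : Summable fun n => ((F * G).coeff n : ℝ) * x ^ n :=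
    ((hF.mul hG).summable h0 h1).of_norm
  have h := tsum_mul_tsum_eq_tsum_sum_antidiagonal_of_summable_norm
    (hF.summable h0 h1) (hG.summable h0 h1)
  rw [hs.tsum_eq, ht.tsum_eq] at h
  rw [h]
  convert hsum.hasSum using 1
  refine tsum_congr fun n => ?_
  rw [PowerSeries.coeff_mul]
  push_cast
  rw [Finset.sum_mul]
  refine Finset.sum_congr rfl fun p hp => ?_
  rw [← HasAntidiagonal.mem_antidiagonal.1 hp, pow_add]
  ring

/-- Turns an algebraic relation between the values into one vanishing power series with controlled
integer coefficients. -/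
theorem hasSum_coeff_aeval {σ : Type*} {f : σ → PowerSeries ℤ} {ξ : σ → ℝ} {x : ℝ}
    (hf : ∀ i, PolyBounded (f i)) (h0 : 0 < x) (h1 : x < 1)
    (hξ : ∀ i, HasSum (fun n => ((f i).coeff n : ℝ) * x ^ n) (ξ i)) (P : MvPolynomial σ ℤ) :
    PolyBounded (MvPolynomial.aeval f P) ∧
      HasSum (fun n => ((MvPolynomial.aeval f P).coeff n : ℝ) * x ^ n)
        (MvPolynomial.aeval ξ P) := by
  induction P using MvPolynomial.induction_on with
  | C a =>
    have hC : (MvPolynomial.aeval f (MvPolynomial.C a) : PowerSeries ℤ) = PowerSeries.C a := by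
      rw [MvPolynomial.aeval_C]
      rfl
    rw [hC, MvPolynomial.aeval_C]
    refine ⟨polyBounded_C a, ?_⟩
    convert hasSum_single (f := fun n => ((PowerSeries.C a).coeff n : ℝ) * x ^ n) 0 ?_ using 1
    · simp
    · intro n hn
      rw [PowerSeries.coeff_C, if_neg hn]
      simp
  | add p q hp hq =>
    rw [map_add, map_add]
    refine ⟨hp.1.add hq.1, (hp.2.add hq.2).congr_fun ?_⟩
    intro n
    simp only [map_add]
    push_cast
    ring
  | mul_X p i hp =>
    rw [map_mul, map_mul, MvPolynomial.aeval_X, MvPolynomial.aeval_X]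
    exact ⟨hp.1.mul (hf i), hasSum_coeff_mul hp.1 (hf i) h0 h1 hp.2 (hξ i)⟩

/-! ### Counting nonzero coefficients; gap series. -/

/-- The number of nonzero coefficients of `F` of index less than `N`. -/
noncomputable def suppCount (F : PowerSeries ℤ) (N : ℕ) : ℕ :=
  #{n ∈ range N | F.coeff n ≠ 0}

theorem suppCount_mul_le (F G : PowerSeries ℤ) (N : ℕ) :
    suppCount (F * G) N ≤ suppCount F N * suppCount G N := by
  classical
  rw [suppCount, suppCount, suppCount, ← Finset.card_product]
  refine (Finset.card_le_card fun n hn => ?_).trans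
    (Finset.card_image_le (f := fun p : ℕ × ℕ => p.1 + p.2))
  rw [Finset.mem_filter, Finset.mem_range, PowerSeries.coeff_mul] at hn
  obtain ⟨p, hp, hne⟩ := Finset.exists_ne_zero_of_sum_ne_zero hn.2
  have hp' := HasAntidiagonal.mem_antidiagonal.1 hp
  refine Finset.mem_image.2 ⟨p, ?_, hp'⟩
  simp only [Finset.mem_product, Finset.mem_filter, Finset.mem_range]
  exact ⟨⟨by omega, left_ne_zero_of_mul hne⟩, ⟨by omega, right_ne_zero_of_mul hne⟩⟩

theorem suppCount_one_le (N : ℕ) : suppCount 1 N ≤ 1 := by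
  refine (Finset.card_le_card (t := {0}) fun n hn => ?_).trans_eq (Finset.card_singleton 0)
  rw [Finset.mem_filter, PowerSeries.coeff_one] at hn
  by_contra h
  simp_all

theorem suppCount_pow_le (F : PowerSeries ℤ) (k N : ℕ) :
    suppCount (F ^ k) N ≤ suppCount F N ^ k := by
  induction k with
  | zero => simpa using suppCount_one_le N
  | succ k ih =>
    rw [pow_succ, pow_succ]
    exact (suppCount_mul_le _ _ _).trans (Nat.mul_le_mul_right _ ih)

theorem suppCount_finsuppProd_le {σ : Type*} (f : σ → PowerSeries ℤ) (k : σ →₀ ℕ) (N : ℕ) :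
    suppCount (k.prod fun i e => f i ^ e) N ≤ k.prod fun i e => suppCount (f i) N ^ e := by
  classical
  unfold Finsupp.prod
  induction k.support using Finset.induction_on with
  | empty => simpa using suppCount_one_le N
  | insert i s hi ih =>
    rw [Finset.prod_insert hi, Finset.prod_insert hi]
    exact (suppCount_mul_le _ _ _).trans (Nat.mul_le_mul (suppCount_pow_le _ _ _) ih)

/-- The power series `1 + ∑ X ^ a m`, for a sequence `a` with `m ≤ a m`. -/
noncomputable def gapSeries (a : ℕ → ℕ) : PowerSeries ℤ :=
  PowerSeries.mk fun n => (if n = 0 then 1 else 0) + (#{m ∈ range (n + 1) | a m = n} : ℤ)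

theorem coeff_gapSeries_nonneg (a : ℕ → ℕ) (n : ℕ) : 0 ≤ (gapSeries a).coeff n := by
  rw [gapSeries, PowerSeries.coeff_mk]
  split_ifs <;> positivity

theorem coeff_gapSeries_pos {a : ℕ → ℕ} (ha : ∀ m, m ≤ a m) (m : ℕ) :
    0 < (gapSeries a).coeff (a m) := by
  rw [gapSeries, PowerSeries.coeff_mk]
  have : 0 < #{m' ∈ range (a m + 1) | a m' = a m} :=
    Finset.card_pos.2 ⟨m, by simp [Nat.lt_succ_of_le (ha m)]⟩
  split_ifs <;> positivity

theorem suppCount_gapSeries_le {a : ℕ → ℕ} (ha : ∀ m, m ≤ a m) (N : ℕ) :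
    suppCount (gapSeries a) N ≤ 1 + #{m ∈ range N | a m < N} := by
  classical
  have : #(insert 0 ({m ∈ range N | a m < N}.image a)) ≤ 1 + #{m ∈ range N | a m < N} := by
    rw [add_comm]
    exact (Finset.card_insert_le _ _).trans (Nat.add_le_add_right Finset.card_image_le 1)
  refine (Finset.card_le_card fun n hn => ?_).trans this
  rw [Finset.mem_filter, Finset.mem_range, gapSeries, PowerSeries.coeff_mk] at hn
  by_cases h0 : n = 0
  · simp [h0]
  · rw [if_neg h0, zero_add] at hn
    have hne : #{m ∈ range (n + 1) | a m = n} ≠ 0 := by exact_mod_cast hn.2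
    obtain ⟨m, hm⟩ := Finset.card_ne_zero.1 hne
    obtain ⟨hm1, rfl⟩ := Finset.mem_filter.1 hm
    refine Finset.mem_insert_of_mem (Finset.mem_image_of_mem a (Finset.mem_filter.2 ⟨?_, hn.1⟩))
    exact Finset.mem_range.2 ((ha m).trans_lt hn.1)

theorem polyBounded_gapSeries (a : ℕ → ℕ) : PolyBounded (gapSeries a) := by
  refine ⟨2, 1, fun n => ?_⟩
  rw [gapSeries, PowerSeries.coeff_mk]
  have h : ((#{m ∈ range (n + 1) | a m = n} : ℕ) : ℝ) ≤ n + 1 := by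
    exact_mod_cast (Finset.card_filter_le _ _).trans_eq (Finset.card_range _)
  have hn : (0 : ℝ) ≤ n := Nat.cast_nonneg n
  push_cast
  rw [abs_of_nonneg (by split_ifs <;> positivity)]
  split_ifs <;> linarith

theorem hasSum_gapSeries {a : ℕ → ℕ} (ha : ∀ m, m ≤ a m) {x : ℝ}
    (hs : Summable fun m => x ^ a m) :
    HasSum (fun n => ((gapSeries a).coeff n : ℝ) * x ^ n) (1 + ∑' m, x ^ a m) := by
  have h1 : HasSum (fun n : ℕ => if n = 0 then (1 : ℝ) else 0) 1 := hasSum_ite_eq 0 1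
  refine (h1.add (hs.hasSum.tsum_fiberwise a)).congr_fun fun n => ?_
  -- Since `m ≤ a m`, the whole fibre over `n` already lies in `range (n + 1)`.
  have hfib : a ⁻¹' {n} = ↑({m ∈ range (n + 1) | a m = n} : Finset ℕ) := by
    ext m
    simp only [Set.mem_preimage, Set.mem_singleton_iff, Finset.coe_filter, Finset.mem_range,
      Set.mem_ofPred_eq]
    exact ⟨fun h => ⟨h ▸ Nat.lt_succ_of_le (ha m), h⟩, fun h => h.2⟩
  rw [hfib, Finset.tsum_subtype' _ (fun m => x ^ a m),
    Finset.sum_congr rfl fun m hm => by rw [(Finset.mem_filter.1 hm).2], Finset.sum_const,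
    gapSeries, PowerSeries.coeff_mk]
  push_cast
  by_cases h : n = 0 <;> simp [h]

/-! ### Growth, density and spacing of the exponents `⌊φ(y; m)⌋`. -/

theorem rpow_add_le_rpow_add {t s a : ℝ} (ht : 1 ≤ t) (hs : 0 ≤ s) (ha0 : 0 ≤ a) (ha1 : a ≤ 1) :
    (t + s) ^ a ≤ t ^ a + s := by
  have ht0 : 0 < t := by linarith
  have hst : 0 ≤ s / t := by positivity
  have h1 : (1 + s / t) ^ a ≤ 1 + s / t :=
    (rpow_one_add_le_one_add_mul_self (by linarith) ha0 ha1).trans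
      (by nlinarith)
  have h2 : t + s = t * (1 + s / t) := by field_simp
  have h3 : t ^ a ≤ t := Real.rpow_le_self_of_one_le ht ha1
  rw [h2, Real.mul_rpow ht0.le (by linarith)]
  calc _ ≤ t ^ a * (1 + s / t) := by gcongr
    _ = t ^ a + t ^ a * (s / t) := by ring
    _ ≤ t ^ a + t * (s / t) := by gcongr
    _ = _ := by field_simp

theorem rpow_sub_mul_le_sub_rpow {t s a : ℝ} (ht : 0 < t) (hs : 0 ≤ s) (hst : s ≤ t)
    (ha1 : a ≤ 1) : t ^ a - s * t ^ (a - 1) ≤ (t - s) ^ a := by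
  have h0 : 0 ≤ s / t := by positivity
  have h0' : s / t ≤ 1 := (div_le_one ht).2 hst
  have h1 : 1 - s / t ≤ (1 - s / t) ^ a :=
    Real.self_le_rpow_of_le_one (by linarith) (by linarith) ha1
  have h2 : t - s = t * (1 - s / t) := by field_simp
  rw [h2, Real.mul_rpow ht.le (by linarith), Real.rpow_sub_one ht.ne']
  calc _ = t ^ a * (1 - s / t) := by field_simp
    _ ≤ _ := by gcongr

/-- For `u ≥ 1` the power `u ^ (1 + y)` grows at least as fast as `u`, and raising `log R` to `log
(R + 1)` multiplies `exp` by `1 + 1 / R`. -/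
theorem phiGrowth_add_div_le {y R : ℝ} (hy : 0 ≤ y) (hR : Real.exp 1 ≤ R) :
    phiGrowth y R + phiGrowth y R / R ≤ phiGrowth y (R + 1) := by
  have hR0 : 0 < R := (Real.exp_pos 1).trans_le hR
  have hu : 1 ≤ Real.log R := (Real.le_log_iff_exp_le hR0).2 hR
  have huv : Real.log R ≤ Real.log (R + 1) := Real.log_le_log hR0 (by linarith)
  set u := Real.log R
  set v := Real.log (R + 1)
  have hy1 : 1 ≤ u ^ y := Real.one_le_rpow hu hy
  have hyy : u ^ y ≤ v ^ y := Real.rpow_le_rpow (by linarith) huv hy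
  have hpow : u ^ (1 + y) + (v - u) ≤ v ^ (1 + y) := by
    rw [Real.rpow_add (by linarith), Real.rpow_add (by linarith), Real.rpow_one, Real.rpow_one]
    nlinarith
  have hexp : Real.exp (v - u) = 1 + 1 / R := by
    rw [Real.exp_sub, Real.exp_log (by linarith), Real.exp_log hR0]
    field_simp
  calc _ = phiGrowth y R * Real.exp (v - u) := by rw [hexp]; ring
    _ = Real.exp (u ^ (1 + y) + (v - u)) := by rw [Real.exp_add, phiGrowth]
    _ ≤ _ := Real.exp_le_exp.2 hpow

theorem phiGrowth_mono {y R R' : ℝ} (hy : 0 ≤ y) (hR : 1 ≤ R) (h : R ≤ R') :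
    phiGrowth y R ≤ phiGrowth y R' := by
  refine Real.exp_le_exp.2 (Real.rpow_le_rpow (Real.log_nonneg hR) ?_ (by linarith))
  exact Real.log_le_log (by linarith) h

/-- The exponents `⌊φ(y; m + 1)⌋`. -/
noncomputable def floorGrowth (y : ℝ) (m : ℕ) : ℕ := ⌊phiGrowth y ((m : ℝ) + 1)⌋₊

theorem floorGrowth_mono {y : ℝ} (hy : 0 ≤ y) : Monotone (floorGrowth y) := fun m m' h =>
  Nat.floor_mono (phiGrowth_mono hy (by simp) (by gcongr))

theorem self_le_floorGrowth {y : ℝ} (hy : 0 ≤ y) (m : ℕ) : m ≤ floorGrowth y m := by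
  have hpos : (0 : ℝ) < (m : ℝ) + 1 := by positivity
  refine Nat.le_floor ?_
  rcases Nat.lt_or_ge m 2 with hm | hm
  · have h1 : (1 : ℝ) ≤ phiGrowth y ((m : ℝ) + 1) :=
      Real.one_le_exp (Real.rpow_nonneg (Real.log_nonneg (by simp)) _)
    have h2 : (m : ℝ) ≤ 1 := by exact_mod_cast Nat.le_of_lt_succ hm
    linarith
  · have hm' : (2 : ℝ) ≤ m := by exact_mod_cast hm
    have hlog : 1 ≤ Real.log ((m : ℝ) + 1) := by
      rw [Real.le_log_iff_exp_le hpos]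
      linarith [Real.exp_one_lt_d9]
    have : (m : ℝ) + 1 ≤ phiGrowth y ((m : ℝ) + 1) := by
      rw [phiGrowth, ← Real.log_le_iff_le_exp hpos]
      exact Real.self_le_rpow_of_one_le hlog (by linarith)
    linarith

/-- `φ(y; R) ≤ exp (t + 2)` means `log R ≤ (t + 2) ^ (1 + y)⁻¹`, and the shift by `2` costs only a
constant factor. The shift leaves room above `exp t` for a gap to the right of every chosen
exponent. -/
theorem suppCount_gapSeries_floorGrowth_le {y t : ℝ} (hy : 0 ≤ y) (ht : 1 ≤ t) {N : ℕ}
    (hN : (N : ℝ) ≤ Real.exp (t + 2)) :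
    (suppCount (gapSeries (floorGrowth y)) N : ℝ) ≤ Real.exp (t ^ (1 + y)⁻¹ + 3) := by
  have hp : 0 < 1 + y := by linarith
  have ha1 : (1 + y)⁻¹ ≤ 1 := inv_le_one_of_one_le₀ (by linarith)
  have hcount : #{m ∈ range N | floorGrowth y m < N} ≤ ⌊Real.exp (t ^ (1 + y)⁻¹ + 2)⌋₊ := by
    rw [← Finset.card_range ⌊Real.exp (t ^ (1 + y)⁻¹ + 2)⌋₊]
    refine Finset.card_le_card fun m hm => ?_
    have hm2 := (Finset.mem_filter.1 hm).2
    have h1 : phiGrowth y ((m : ℝ) + 1) < N := (Nat.floor_lt (Real.exp_pos _).le).1 hm2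
    have h2 : Real.log ((m : ℝ) + 1) ^ (1 + y) ≤ t + 2 :=
      Real.exp_le_exp.1 (h1.le.trans hN)
    have h3 : Real.log ((m : ℝ) + 1) ≤ (t + 2) ^ (1 + y)⁻¹ :=
      (Real.le_rpow_inv_iff_of_pos (Real.log_nonneg (by simp)) (by linarith) hp).2 h2
    have h4 := h3.trans (rpow_add_le_rpow_add ht zero_le_two (inv_nonneg.2 hp.le) ha1)
    rw [Real.log_le_iff_le_exp (by positivity)] at h4
    rw [Finset.mem_range, Nat.lt_iff_add_one_le]
    exact Nat.le_floor (by exact_mod_cast h4)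
  have h5 : (suppCount (gapSeries (floorGrowth y)) N : ℝ) ≤
      1 + Real.exp (t ^ (1 + y)⁻¹ + 2) := by
    have h6 : (suppCount (gapSeries (floorGrowth y)) N : ℝ) ≤
        1 + (⌊Real.exp (t ^ (1 + y)⁻¹ + 2)⌋₊ : ℝ) := by
      exact_mod_cast (suppCount_gapSeries_le (self_le_floorGrowth hy) N).trans
        (Nat.add_le_add_left hcount 1)
    exact h6.trans (add_le_add_right (Nat.floor_le (Real.exp_pos _).le) 1)
  have h7 : 1 ≤ Real.exp (t ^ (1 + y)⁻¹ + 2) := Real.one_le_exp (by positivity)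
  have h8 : (2 : ℝ) ≤ Real.exp 1 := by linarith [Real.add_one_le_exp (1 : ℝ)]
  rw [show t ^ (1 + y)⁻¹ + 3 = (t ^ (1 + y)⁻¹ + 2) + 1 by ring, Real.exp_add]
  nlinarith

/-- The indices from `m₀ / 2` to `m₀`, with `m₀` about `exp ((t - 1) ^ a)`, have logarithm `t ^ a +
O(1)`. There consecutive values of `φ` differ by at least `φ / R`, which is `exp (t - O(t ^ (1 -
a)))`. -/
theorem exists_separated_floorGrowth {y : ℝ} (hy : 1 ≤ y) :
    ∃ C : ℝ, 1 ≤ C ∧ ∀ᶠ t : ℝ in atTop, ∃ V : Finset ℕ,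
      (∀ v ∈ V, (∃ m, floorGrowth y m = v) ∧ (v : ℝ) ≤ Real.exp (t - 1)) ∧
      (∀ v ∈ V, ∀ v' ∈ V, v < v' →
        (v : ℝ) + 2 * Real.exp (t - C * t ^ (1 - (1 + y)⁻¹)) ≤ v') ∧
      Real.exp (t ^ (1 + y)⁻¹ - 3) ≤ #V := by
  classical
  have hp : 0 < 1 + y := by linarith
  set a := (1 + y)⁻¹ with ha
  have ha0 : 0 < a := inv_pos.2 hp
  have ha2 : a ≤ 1 - a := by
    have : a ≤ (2 : ℝ)⁻¹ := inv_anti₀ two_pos (by linarith)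
    linarith
  have hap : a * (1 + y) = 1 := inv_mul_cancel₀ hp.ne'
  -- `3 * (1 + y)` pays for `u ≥ t ^ a - 3` (by Bernoulli), one unit for the division by `R`, and
  -- two for the extra factor `exp 2` used to absorb rounding.
  set C := 3 * (1 + y) + 3 with hC
  refine ⟨C, by linarith, ?_⟩
  filter_upwards [eventually_ge_atTop 2,
    (tendsto_rpow_atTop ha0).eventually_ge_atTop (C + 5)] with t ht2 hta
  have ht0 : 0 < t := by linarith
  have hta0 : 0 < t ^ a := Real.rpow_pos_of_pos ht0 a
  set b := (t - 1) ^ a with hb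
  have hbt : b ≤ t ^ a := Real.rpow_le_rpow (by linarith) (by linarith) ha0.le
  have htb : t ^ a - 1 ≤ b := by
    have h1 := rpow_sub_mul_le_sub_rpow (a := a) ht0 zero_le_one (by linarith) (by linarith)
    have h2 : t ^ (a - 1) ≤ 1 := Real.rpow_le_one_of_one_le_of_nonpos (by linarith) (by linarith)
    linarith
  set m₀ := ⌊Real.exp b⌋₊ with hm₀
  have hm₀le : (m₀ : ℝ) ≤ Real.exp b := Nat.floor_le (Real.exp_pos _).le
  have he1 : (2 : ℝ) ≤ Real.exp 1 := by linarith [Real.add_one_le_exp (1 : ℝ)]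
  have hm₀ge : Real.exp (t ^ a - 2) ≤ m₀ := by
    have h1 : Real.exp b < m₀ + 1 := Nat.lt_floor_add_one _
    have h2 : Real.exp (t ^ a - 1) ≤ Real.exp b := Real.exp_le_exp.2 htb
    have h3 : Real.exp (t ^ a - 1) = Real.exp (t ^ a - 2) * Real.exp 1 := by
      rw [← Real.exp_add]; ring_nf
    have h4 : 1 ≤ Real.exp (t ^ a - 2) := Real.one_le_exp (by linarith)
    nlinarith
  have hhalf : Real.exp (t ^ a - 3) ≤ m₀ / 2 := by
    have h3 : Real.exp (t ^ a - 2) = Real.exp (t ^ a - 3) * Real.exp 1 := by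
      rw [← Real.exp_add]; ring_nf
    have h4 := Real.exp_pos (t ^ a - 3)
    nlinarith
  set E := Real.exp (t - C * t ^ (1 - a)) with hE
  have hgap : ∀ m, m₀ / 2 ≤ m → m < m₀ → ∀ m', m < m' →
      (floorGrowth y m : ℝ) + 2 * E ≤ floorGrowth y m' := by
    intro m hm1 hm2 m' hmm'
    have hm1' : (m₀ : ℝ) / 2 ≤ (m : ℝ) + 1 := by
      have : (m₀ : ℝ) ≤ 2 * (m + 1 : ℕ) := by exact_mod_cast (by omega : m₀ ≤ 2 * (m + 1))
      push_cast at this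
      linarith
    have hm2' : (m : ℝ) + 1 ≤ m₀ := by exact_mod_cast hm2
    have hmpos : (0 : ℝ) < (m : ℝ) + 1 := by positivity
    set u := Real.log ((m : ℝ) + 1) with hu
    have hu1 : t ^ a - 3 ≤ u := (Real.le_log_iff_exp_le hmpos).2 (hhalf.trans hm1')
    have hu2 : u ≤ t ^ a := ((Real.log_le_iff_le_exp hmpos).2 (hm2'.trans hm₀le)).trans hbt
    have hexp1 : Real.exp 1 ≤ (m : ℝ) + 1 :=
      (Real.exp_le_exp.2 (by linarith)).trans (hhalf.trans hm1')
    have hstep := phiGrowth_add_div_le (y := y) (by linarith) hexp1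
    have hpow : t - 3 * (1 + y) * t ^ (1 - a) ≤ u ^ (1 + y) := by
      have h1 : (t ^ a - 3) ^ (1 + y) ≤ u ^ (1 + y) :=
        Real.rpow_le_rpow (by linarith) hu1 hp.le
      have hdiv : 3 / t ^ a ≤ 1 := (div_le_one hta0).2 (by linarith)
      have h2 : t ^ a - 3 = t ^ a * (1 + -(3 / t ^ a)) := by field_simp; ring
      have h3 : 1 + (1 + y) * -(3 / t ^ a) ≤ (1 + -(3 / t ^ a)) ^ (1 + y) :=
        one_add_mul_self_le_rpow_one_add (by linarith) (by linarith)
      have h4 : (t ^ a) ^ (1 + y) = t := by rw [← Real.rpow_mul ht0.le, hap, Real.rpow_one]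
      rw [h2, Real.mul_rpow hta0.le (by linarith), h4] at h1
      have h5 : t ^ (1 - a) = t / t ^ a := by rw [Real.rpow_sub ht0, Real.rpow_one]
      calc _ = t * (1 + (1 + y) * -(3 / t ^ a)) := by rw [h5]; ring
        _ ≤ t * (1 + -(3 / t ^ a)) ^ (1 + y) := by gcongr
        _ ≤ _ := h1
    -- Here `y ≥ 1`, that is `a ≤ 1 / 2`, is essential: the loss `u ≤ t ^ a` from dividing by `R` is
    -- absorbed in `t ^ (1 - a)`.
    have hle : t ^ a ≤ t ^ (1 - a) := Real.rpow_le_rpow_of_exponent_le (by linarith) ha2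
    have hquot : Real.exp (t - C * t ^ (1 - a) + 2) ≤
        phiGrowth y ((m : ℝ) + 1) / ((m : ℝ) + 1) := by
      rw [phiGrowth, ← hu, ← Real.exp_log hmpos, ← hu, ← Real.exp_sub]
      refine Real.exp_le_exp.2 ?_
      rw [hC]
      nlinarith
    have hE1 : 1 ≤ E := by
      refine Real.one_le_exp ?_
      have h5 : t = t ^ a * t ^ (1 - a) := by
        rw [← Real.rpow_add ht0]; simp
      have h6 : 0 < t ^ (1 - a) := Real.rpow_pos_of_pos ht0 _
      nlinarith
    have hE3 : 3 * E ≤ Real.exp (t - C * t ^ (1 - a) + 2) := by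
      rw [Real.exp_add, ← hE]
      have : (3 : ℝ) ≤ Real.exp 2 := by linarith [Real.add_one_le_exp (2 : ℝ)]
      nlinarith
    have hfl : (floorGrowth y m : ℝ) ≤ phiGrowth y ((m : ℝ) + 1) :=
      Nat.floor_le (Real.exp_pos _).le
    have hfl' : phiGrowth y ((m : ℝ) + 1 + 1) < floorGrowth y (m + 1) + 1 := by
      have := Nat.lt_floor_add_one (phiGrowth y (((m + 1 : ℕ) : ℝ) + 1))
      rw [floorGrowth]
      push_cast at this ⊢
      exact this
    have hmono : (floorGrowth y (m + 1) : ℝ) ≤ floorGrowth y m' := by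
      exact_mod_cast floorGrowth_mono (by linarith : 0 ≤ y) hmm'
    linarith
  have hE0 : 0 < E := Real.exp_pos _
  have hstrict : Set.InjOn (floorGrowth y) (Finset.Ico (m₀ / 2) m₀ : Finset ℕ) := by
    intro m hm m' hm' h
    have hm := Finset.mem_Ico.1 hm
    have hm' := Finset.mem_Ico.1 hm'
    have h' : (floorGrowth y m : ℝ) = floorGrowth y m' := by exact_mod_cast h
    rcases lt_trichotomy m m' with hlt | heq | hlt
    · linarith [hgap m hm.1 hm.2 m' hlt]
    · exact heq
    · linarith [hgap m' hm'.1 hm'.2 m hlt]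
  refine ⟨(Finset.Ico (m₀ / 2) m₀).image (floorGrowth y), ?_, ?_, ?_⟩
  · intro v hv
    obtain ⟨m, hm, rfl⟩ := Finset.mem_image.1 hv
    refine ⟨⟨m, rfl⟩, (Nat.floor_le (Real.exp_pos _).le).trans (Real.exp_le_exp.2 ?_)⟩
    have hm2 : (m : ℝ) + 1 ≤ m₀ := by exact_mod_cast (Finset.mem_Ico.1 hm).2
    have hlog : Real.log ((m : ℝ) + 1) ≤ b :=
      (Real.log_le_iff_le_exp (by positivity)).2 (hm2.trans hm₀le)
    exact (Real.le_rpow_inv_iff_of_pos (Real.log_nonneg (by simp)) (by linarith) hp).1 hlog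
  · intro v hv v' hv' hlt
    obtain ⟨m, hm, rfl⟩ := Finset.mem_image.1 hv
    obtain ⟨m', hm', rfl⟩ := Finset.mem_image.1 hv'
    have hm := Finset.mem_Ico.1 hm
    refine hgap m hm.1 hm.2 m' ?_
    by_contra hle
    exact absurd (floorGrowth_mono (by linarith : 0 ≤ y) (not_lt.1 hle)) (not_le.2 hlt)
  · rw [Finset.card_image_of_injOn hstrict, Nat.card_Ico]
    refine hhalf.trans ?_
    have : (m₀ : ℝ) ≤ 2 * ((m₀ - m₀ / 2 : ℕ) : ℝ) := by
      exact_mod_cast (by omega : m₀ ≤ 2 * (m₀ - m₀ / 2))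
    linarith

/-! ### Monomials: comparison of weights and separated exponents. -/

/-- The power series `∏ (1 + ∑ X ^ ⌊φ(y; m)⌋) ^ k y`. -/
noncomputable def monomialSeries (k : Set.Ici (1 : ℝ) →₀ ℕ) : PowerSeries ℤ :=
  k.prod fun y e => gapSeries (floorGrowth y) ^ e

/-- The logarithmic growth `∑ k y * t ^ (1 + y)⁻¹` of the number of nonzero coefficients of
`monomialSeries k` of index at most `exp t`. -/
noncomputable def growthWeight (k : Set.Ici (1 : ℝ) →₀ ℕ) (t : ℝ) : ℝ :=
  k.sum fun y e => (e : ℝ) * t ^ (1 + (y : ℝ))⁻¹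

theorem inv_one_add_pos (y : Set.Ici (1 : ℝ)) : 0 < (1 + (y : ℝ))⁻¹ := by
  have : (1 : ℝ) ≤ y := y.2
  positivity

theorem inv_one_add_le (y : Set.Ici (1 : ℝ)) : (1 + (y : ℝ))⁻¹ ≤ 2⁻¹ :=
  inv_anti₀ two_pos (by have : (1 : ℝ) ≤ y := y.2; linarith)

theorem monomialSeries_single_add (y : Set.Ici (1 : ℝ)) (k : Set.Ici (1 : ℝ) →₀ ℕ) :
    monomialSeries (Finsupp.single y 1 + k) = gapSeries (floorGrowth y) * monomialSeries k := by
  classical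
  rw [monomialSeries, Finsupp.prod_add_index' (by simp) (by simp [pow_add]),
    Finsupp.prod_single_index (by simp), pow_one, monomialSeries]

theorem growthWeight_single_add (y : Set.Ici (1 : ℝ)) (k : Set.Ici (1 : ℝ) →₀ ℕ) (t : ℝ) :
    growthWeight (Finsupp.single y 1 + k) t = t ^ (1 + (y : ℝ))⁻¹ + growthWeight k t := by
  classical
  rw [growthWeight, Finsupp.sum_add_index' (by simp) (by simp [add_mul]),
    Finsupp.sum_single_index (by simp), Nat.cast_one, one_mul, growthWeight]

theorem coeff_mul_nonneg {F G : PowerSeries ℤ} (hF : ∀ n, 0 ≤ F.coeff n)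
    (hG : ∀ n, 0 ≤ G.coeff n) (n : ℕ) : 0 ≤ (F * G).coeff n := by
  rw [PowerSeries.coeff_mul]
  exact Finset.sum_nonneg fun p _ => mul_nonneg (hF _) (hG _)

theorem coeff_mul_pos {F G : PowerSeries ℤ} (hF : ∀ n, 0 ≤ F.coeff n)
    (hG : ∀ n, 0 ≤ G.coeff n) {m n : ℕ} (hm : 0 < F.coeff m) (hn : 0 < G.coeff n) :
    0 < (F * G).coeff (m + n) := by
  rw [PowerSeries.coeff_mul]
  exact Finset.sum_pos' (fun p _ => mul_nonneg (hF _) (hG _))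
    ⟨(m, n), HasAntidiagonal.mem_antidiagonal.2 rfl, mul_pos hm hn⟩

theorem coeff_monomialSeries_nonneg (k : Set.Ici (1 : ℝ) →₀ ℕ) :
    ∀ n, 0 ≤ (monomialSeries k).coeff n := by
  classical
  have h1 : ∀ n, 0 ≤ (1 : PowerSeries ℤ).coeff n := fun n => by
    rw [PowerSeries.coeff_one]
    split_ifs <;> simp
  rw [monomialSeries]
  refine Finset.prod_induction _ (fun F : PowerSeries ℤ => ∀ n, 0 ≤ F.coeff n)
    (fun _ _ => coeff_mul_nonneg) h1 fun y _ => ?_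
  induction k y with
  | zero => simpa using h1
  | succ e ih =>
    simp only [pow_succ]
    exact coeff_mul_nonneg ih (coeff_gapSeries_nonneg _)

theorem suppCount_monomialSeries_le (k : Set.Ici (1 : ℝ) →₀ ℕ) {t : ℝ} (ht : 1 ≤ t) {N : ℕ}
    (hN : (N : ℝ) ≤ Real.exp (t + 2)) :
    (suppCount (monomialSeries k) N : ℝ) ≤ Real.exp (growthWeight k t + 3 * k.degree) := by
  have h : (suppCount (monomialSeries k) N : ℝ) ≤
      ∏ y ∈ k.support, (suppCount (gapSeries (floorGrowth y)) N : ℝ) ^ k y := by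
    exact_mod_cast suppCount_finsuppProd_le (fun y : Set.Ici (1 : ℝ) => gapSeries (floorGrowth y))
      k N
  refine h.trans ?_
  have h2 : growthWeight k t + 3 * k.degree =
      ∑ y ∈ k.support, (k y : ℝ) * (t ^ (1 + (y : ℝ))⁻¹ + 3) := by
    rw [growthWeight, Finsupp.sum, Finsupp.degree_apply]
    push_cast
    rw [Finset.mul_sum, ← Finset.sum_add_distrib]
    exact Finset.sum_congr rfl fun y _ => by ring
  rw [h2, Real.exp_sum]
  refine Finset.prod_le_prod (fun _ _ => by positivity) fun y _ => ?_
  rw [Real.exp_nat_mul]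
  gcongr
  exact suppCount_gapSeries_floorGrowth_le (by have : (1 : ℝ) ≤ y := y.2; linarith) ht hN

theorem growthWeight_eq_sum {k : Set.Ici (1 : ℝ) →₀ ℕ} {s : Finset (Set.Ici (1 : ℝ))}
    (hs : k.support ⊆ s) (t : ℝ) :
    growthWeight k t = ∑ y ∈ s, (k y : ℝ) * t ^ (1 + (y : ℝ))⁻¹ :=
  Finsupp.sum_of_support_subset _ hs _ (by simp)

/-- Divide by `t ^ (1 + j)⁻¹`, where `j` is the first index at which `k` and `g` differ: smaller
indices cancel, and larger ones have smaller powers of `t`. -/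
theorem tendsto_growthWeight_sub {k g : Set.Ici (1 : ℝ) →₀ ℕ} (h : toLex k < toLex g) :
    Tendsto (fun t => growthWeight g t - growthWeight k t) atTop atTop := by
  classical
  obtain ⟨j, hj, hlt⟩ := Finsupp.Lex.lt_iff.1 h
  change ∀ d, d < j → k d = g d at hj
  change k j < g j at hlt
  set s := insert j (k.support ∪ g.support) with hs
  have hks : k.support ⊆ s :=
    Finset.subset_union_left.trans (Finset.subset_insert _ _)
  have hgs : g.support ⊆ s :=
    Finset.subset_union_right.trans (Finset.subset_insert _ _)
  have hpos : (0 : ℝ) < (g j : ℝ) - k j := by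
    have : (k j : ℝ) < g j := by exact_mod_cast hlt
    linarith
  have hlim : Tendsto (fun t : ℝ => ∑ y ∈ s, ((g y : ℝ) - k y) *
      t ^ ((1 + (y : ℝ))⁻¹ - (1 + (j : ℝ))⁻¹)) atTop
      (𝓝 (∑ y ∈ s, if y = j then (g j : ℝ) - k j else 0)) := by
    refine tendsto_finsetSum _ fun y _ => ?_
    rcases lt_trichotomy y j with hy | rfl | hy
    · rw [if_neg hy.ne, hj y hy]
      simp
    · simp
    · rw [if_neg hy.ne']
      have hyj : (j : ℝ) < y := hy
      have hj1 : (1 : ℝ) ≤ j := j.2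
      have hexp : (1 + (y : ℝ))⁻¹ < (1 + (j : ℝ))⁻¹ := inv_strictAnti₀ (by linarith) (by linarith)
      have := (tendsto_rpow_neg_atTop (sub_pos.2 hexp)).const_mul ((g y : ℝ) - k y)
      simpa using this
  rw [Finset.sum_ite_eq' s j, if_pos (Finset.mem_insert_self _ _)] at hlim
  refine (hlim.pos_mul_atTop hpos (tendsto_rpow_atTop (inv_one_add_pos j))).congr' ?_
  filter_upwards [eventually_gt_atTop 0] with t ht
  rw [growthWeight_eq_sum hks, growthWeight_eq_sum hgs, ← Finset.sum_sub_distrib, Finset.sum_mul]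
  refine Finset.sum_congr rfl fun y _ => ?_
  rw [Real.rpow_sub ht]
  have := (Real.rpow_pos_of_pos ht (1 + (j : ℝ))⁻¹).ne'
  field_simp

theorem tendsto_growthWeight_div (k : Set.Ici (1 : ℝ) →₀ ℕ) :
    Tendsto (fun t => growthWeight k t / t) atTop (𝓝 0) := by
  have h : Tendsto (fun t : ℝ => ∑ y ∈ k.support, (k y : ℝ) * t ^ (-(1 - (1 + (y : ℝ))⁻¹)))
      atTop (𝓝 (∑ y ∈ k.support, (k y : ℝ) * 0)) := by
    refine tendsto_finsetSum _ fun y _ => (tendsto_rpow_neg_atTop ?_).const_mul _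
    linarith [inv_one_add_le y]
  rw [Finset.sum_congr rfl fun y _ => mul_zero (k y : ℝ), Finset.sum_const_zero] at h
  refine h.congr' ?_
  filter_upwards [eventually_gt_atTop 0] with t ht
  rw [growthWeight, Finsupp.sum, Finset.sum_div]
  refine Finset.sum_congr rfl fun y _ => ?_
  rw [neg_sub, Real.rpow_sub ht, Real.rpow_one, mul_div_assoc]

/-- Powers with exponent at most `a` have derivative `O(t ^ (a - 1))`, so a shift of order `t ^ (1 -
a)` costs a bounded amount. -/
theorem growthWeight_sub_le {k : Set.Ici (1 : ℝ) →₀ ℕ} {a t C : ℝ} (ht : 1 ≤ t) (hC : 0 ≤ C)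
    (hCt : C * t ^ (1 - a) ≤ t) (hk : ∀ y ∈ k.support, (1 + (y : ℝ))⁻¹ ≤ a) :
    growthWeight k t - C * k.degree ≤ growthWeight k (t - C * t ^ (1 - a)) := by
  have ht0 : 0 < t := by linarith
  rw [growthWeight, growthWeight, Finsupp.sum, Finsupp.sum, Finsupp.degree_apply]
  push_cast
  rw [Finset.mul_sum, ← Finset.sum_sub_distrib]
  refine Finset.sum_le_sum fun y hy => ?_
  have h1 := rpow_sub_mul_le_sub_rpow (a := (1 + (y : ℝ))⁻¹) ht0
    (by positivity : 0 ≤ C * t ^ (1 - a)) hCt (by linarith [inv_one_add_le y])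
  have h2 : C * t ^ (1 - a) * t ^ ((1 + (y : ℝ))⁻¹ - 1) ≤ C := by
    rw [mul_assoc, ← Real.rpow_add ht0]
    have : t ^ (1 - a + ((1 + (y : ℝ))⁻¹ - 1)) ≤ 1 :=
      Real.rpow_le_one_of_one_le_of_nonpos ht (by linarith [hk y hy])
    nlinarith
  have h3 : t ^ (1 + (y : ℝ))⁻¹ - C ≤ (t - C * t ^ (1 - a)) ^ (1 + (y : ℝ))⁻¹ := by linarith
  calc _ = (k y : ℝ) * (t ^ (1 + (y : ℝ))⁻¹ - C) := by ring
    _ ≤ _ := by gcongr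

/-- For large `t`, the support of `monomialSeries g` has at least `exp (growthWeight g t - C)`
elements below `exp t` with distances at least `exp (δ * t)`. -/
theorem exists_separated_monomialSeries (n : ℕ) : ∀ g : Set.Ici (1 : ℝ) →₀ ℕ, g.degree = n →
    ∀ δ : ℝ, 0 ≤ δ → δ < 1 → ∃ C : ℝ, ∀ᶠ t : ℝ in atTop, ∃ U : Finset ℕ,
      (∀ u ∈ U, 0 < (monomialSeries g).coeff u ∧ (u : ℝ) ≤ Real.exp t) ∧
      (∀ u ∈ U, ∀ v ∈ U, u < v → (u : ℝ) + Real.exp (δ * t) ≤ v) ∧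
      Real.exp (growthWeight g t - C) ≤ #U := by
  classical
  induction n with
  | zero =>
    intro g hg δ _ _
    have hg0 : g = 0 := (Finsupp.degree_eq_zero_iff g).1 hg
    subst hg0
    refine ⟨0, Eventually.of_forall fun t => ⟨{0}, ?_, ?_, ?_⟩⟩
    · simp [monomialSeries, (Real.exp_pos t).le]
    · simp
    · simp [growthWeight]
  | succ n ih =>
    intro g hg δ hδ0 hδ1
    have hne : g.support.Nonempty := by
      rw [Finsupp.support_nonempty_iff]
      rintro rfl
      simp at hg
    -- Splitting off the smallest `y` makes `(1 + y)⁻¹` the largest exponent, as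
    -- `growthWeight_sub_le` requires for the remaining factor.
    set y := g.support.min' hne with hy
    have hymem : y ∈ g.support := Finset.min'_mem _ _
    have hle : Finsupp.single y 1 ≤ g := by
      rw [Finsupp.single_le_iff]
      exact Nat.one_le_iff_ne_zero.2 (Finsupp.mem_support_iff.1 hymem)
    obtain ⟨k, hk⟩ := exists_add_of_le hle
    have hdeg : k.degree = n := by
      rw [hk, map_add, Finsupp.degree_single] at hg
      omega
    have hksupp : ∀ z ∈ k.support, (1 + (z : ℝ))⁻¹ ≤ (1 + (y : ℝ))⁻¹ := by
      intro z hz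
      have hzg : z ∈ g.support := by
        rw [Finsupp.mem_support_iff] at hz ⊢
        rw [hk, Finsupp.add_apply]
        omega
      have h1 : (y : ℝ) ≤ z := Finset.min'_le _ _ hzg
      have h2 : (1 : ℝ) ≤ y := y.2
      exact inv_anti₀ (by linarith) (by linarith)
    obtain ⟨C₁, hC₁', hV⟩ := exists_separated_floorGrowth y.2
    -- The remaining factor is used at `t' ≥ (1 + δ) / 2 * t`, and `((1 + δ) / 2) ^ 2 ≥ δ`.
    obtain ⟨C₂, hU⟩ := ih k hdeg ((1 + δ) / 2) (by linarith) (by linarith)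
    have hC₁ : 0 ≤ C₁ := by linarith
    set a := (1 + (y : ℝ))⁻¹ with ha
    have ha0 : 0 < a := inv_one_add_pos y
    have hsmall : Tendsto (fun t : ℝ => C₁ * t ^ (-a)) atTop (𝓝 0) := by
      simpa using (tendsto_rpow_neg_atTop ha0).const_mul C₁
    have hev : ∀ᶠ t : ℝ in atTop, C₁ * t ^ (1 - a) ≤ (1 - δ) / 2 * t := by
      filter_upwards [hsmall.eventually (gt_mem_nhds (by linarith : 0 < (1 - δ) / 2)),
        eventually_gt_atTop 0] with t ht ht0
      have h1 : t ^ (1 - a) = t ^ (-a) * t := by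
        rw [sub_eq_neg_add, Real.rpow_add ht0, Real.rpow_one]
      rw [h1, ← mul_assoc]
      gcongr
    have htend : Tendsto (fun t : ℝ => t - C₁ * t ^ (1 - a)) atTop atTop := by
      refine tendsto_atTop_mono' _ ?_ (tendsto_id.const_mul_atTop
        (by linarith : 0 < (1 + δ) / 2))
      filter_upwards [hev] with t ht
      simp only [id]
      linarith
    refine ⟨3 + C₁ * k.degree + C₂, ?_⟩
    filter_upwards [hV, htend.eventually hU, hev, eventually_ge_atTop 1,
      (tendsto_rpow_atTop (by linarith [inv_one_add_le y] : 0 < 1 - a)).eventually_ge_atTop 1]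
      with t ⟨V, hV1, hV2, hV3⟩ ⟨U, hU1, hU2, hU3⟩ hCt ht1 htp
    have hCt' : C₁ * t ^ (1 - a) ≤ t := by nlinarith
    set t' := t - C₁ * t ^ (1 - a) with ht'
    have hδt' : Real.exp (δ * t) ≤ Real.exp ((1 + δ) / 2 * t') := by
      refine Real.exp_le_exp.2 ?_
      have : (1 + δ) / 2 * t ≤ t' := by linarith
      have h2 : (1 + δ) / 2 * ((1 + δ) / 2 * t) ≤ (1 + δ) / 2 * t' := by gcongr
      nlinarith [mul_nonneg (sq_nonneg (1 - δ)) (by linarith : 0 ≤ t)]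
    have ht'0 : 0 ≤ t' := by linarith
    have hexpt' : Real.exp ((1 + δ) / 2 * t') ≤ Real.exp t' :=
      Real.exp_le_exp.2 (by nlinarith)
    -- Elements of `V` are `2 * exp t'` apart: one `exp t'` absorbs `u`, the other leaves the
    -- required distance. Thus the sums `v + u` are ordered lexicographically.
    have hsep : ∀ v ∈ V, ∀ u ∈ U, ∀ v' ∈ V, ∀ u' ∈ U, (v < v' ∨ v = v' ∧ u < u') →
        ((v + u : ℕ) : ℝ) + Real.exp (δ * t) ≤ (v' + u' : ℕ) := by
      intro v hv u hu v' hv' u' hu' h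
      push_cast
      rcases h with h | ⟨rfl, h⟩
      · have h1 := hV2 v hv v' hv' h
        have h2 := (hU1 u hu).2
        have h3 : (0 : ℝ) ≤ u' := Nat.cast_nonneg _
        linarith
      · linarith [hU2 u hu u' hu' h]
    have hEpos := Real.exp_pos (δ * t)
    have hcases : ∀ p q : ℕ × ℕ, p ≠ q → (p.1 < q.1 ∨ p.1 = q.1 ∧ p.2 < q.2) ∨
        (q.1 < p.1 ∨ q.1 = p.1 ∧ q.2 < p.2) := by
      intro p q hpq
      have : ¬ (p.1 = q.1 ∧ p.2 = q.2) := fun h => hpq (Prod.ext h.1 h.2)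
      omega
    refine ⟨(V ×ˢ U).image fun p => p.1 + p.2, ?_, ?_, ?_⟩
    · intro w hw
      obtain ⟨⟨v, u⟩, hp, rfl⟩ := Finset.mem_image.1 hw
      obtain ⟨hv, hu⟩ := Finset.mem_product.1 hp
      obtain ⟨⟨m, hm⟩, hvt⟩ := hV1 v hv
      obtain ⟨hupos, hut⟩ := hU1 u hu
      refine ⟨?_, ?_⟩
      · rw [hk, monomialSeries_single_add]
        refine coeff_mul_pos (coeff_gapSeries_nonneg _) (coeff_monomialSeries_nonneg k) ?_ hupos
        change 0 < (gapSeries (floorGrowth y)).coeff v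
        rw [← hm]
        exact coeff_gapSeries_pos
          (self_le_floorGrowth (by have : (1 : ℝ) ≤ y := y.2; linarith)) m
      · push_cast
        have h1 : Real.exp t = Real.exp (t - 1) * Real.exp 1 := by rw [← Real.exp_add]; ring_nf
        have he1 : (2 : ℝ) ≤ Real.exp 1 := by linarith [Real.add_one_le_exp (1 : ℝ)]
        have h2 : Real.exp t' ≤ Real.exp (t - 1) := Real.exp_le_exp.2 (by nlinarith)
        have h3 := Real.exp_pos (t - 1)
        nlinarith
    · intro w hw w' hw' hlt
      obtain ⟨⟨v, u⟩, hp, rfl⟩ := Finset.mem_image.1 hw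
      obtain ⟨⟨v', u'⟩, hp', rfl⟩ := Finset.mem_image.1 hw'
      obtain ⟨hv, hu⟩ := Finset.mem_product.1 hp
      obtain ⟨hv', hu'⟩ := Finset.mem_product.1 hp'
      rcases hcases (v, u) (v', u') (by rintro ⟨⟩; exact lt_irrefl _ hlt) with h | h
      · exact hsep v hv u hu v' hv' u' hu' h
      · have h1 := hsep v' hv' u' hu' v hv u hu h
        have h2 : ((v + u : ℕ) : ℝ) < ((v' + u' : ℕ) : ℝ) := by exact_mod_cast hlt
        linarith
    · rw [Finset.card_image_of_injOn, Finset.card_product]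
      · push_cast
        have h1 := growthWeight_sub_le ht1 hC₁ hCt' hksupp
        calc _ ≤ Real.exp (t ^ a - 3) * Real.exp (growthWeight k t' - C₂) := by
              rw [← Real.exp_add, Real.exp_le_exp, hk, growthWeight_single_add]
              linarith
          _ ≤ _ := mul_le_mul hV3 hU3 (Real.exp_pos _).le (Nat.cast_nonneg _)
      · rintro ⟨v, u⟩ hp ⟨v', u'⟩ hp' heq
        obtain ⟨hv, hu⟩ := Finset.mem_product.1 hp
        obtain ⟨hv', hu'⟩ := Finset.mem_product.1 hp'
        have heq' : ((v + u : ℕ) : ℝ) = (v' + u' : ℕ) := by exact_mod_cast heq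
        by_contra hpq
        rcases hcases _ _ hpq with h | h
        · linarith [hsep v hv u hu v' hv' u' hu' h]
        · linarith [hsep v' hv' u' hu' v hv u hu h]

/-! ### Gaps, the counting contradiction and the conclusion. -/

/-- Pigeonhole: of `#s + 1` consecutive blocks of length `M`, one misses `s`. -/
theorem exists_gap (s : Finset ℕ) (x M : ℕ) :
    ∃ a, x ≤ a ∧ a ≤ x + M * #s ∧ ∀ n ∈ s, ¬(a ≤ n ∧ n < a + M) := by
  classical
  rcases Nat.eq_zero_or_pos M with rfl | hM
  · exact ⟨x, le_rfl, by simp, fun n _ => by omega⟩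
  by_contra! h
  have hsub : range (#s + 1) ⊆ s.image fun n => (n - x) / M := by
    intro j hj
    have hj' : M * j ≤ M * #s := Nat.mul_le_mul_left _ (Nat.lt_succ_iff.1 (Finset.mem_range.1 hj))
    obtain ⟨n, hn, h1, h2⟩ := h (x + M * j) (by omega) (by omega)
    refine Finset.mem_image.2 ⟨n, hn, Nat.div_eq_of_lt_le ?_ ?_⟩
    · rw [mul_comm]
      omega
    · rw [add_mul, mul_comm j M]
      omega
  have := (Finset.card_le_card hsub).trans Finset.card_image_le
  rw [Finset.card_range] at this
  omega

/-- Each `u ∈ U` sits between two gaps within distance `D`, so the sum of `c` in between is `0`.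
Positivity of `ρ u` then forces an element of `T` within `D` of `u`, and by separation distinct `u`
get distinct elements. -/
theorem card_le_of_partial_sum_eq_zero {c ρ : ℕ → ℤ} {A : ℤ} (hA : A ≠ 0) (hρ : ∀ n, 0 ≤ ρ n)
    {x : ℝ} (hx : 0 < x) {N M D : ℕ} (hM : ∀ R ≤ N, (∀ n, R ≤ n → n < R + M → c n = 0) →
      ∑ n ∈ range R, (c n : ℝ) * x ^ n = 0)
    {T S U : Finset ℕ} (hT : ∀ n < N, n ∉ T → c n = A * ρ n) (hS : ∀ n < N, c n ≠ 0 → n ∈ S)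
    (hD : M * #S + M + 1 ≤ D) (hU : ∀ u ∈ U, 0 < ρ u ∧ u + D ≤ N)
    (hsep : ∀ u ∈ U, ∀ v ∈ U, u < v → u + 2 * D < v) : #U ≤ #T := by
  have hex : ∀ u ∈ U, ∃ τ ∈ T, u ≤ τ + D ∧ τ ≤ u + D := by
    intro u hu
    obtain ⟨hρu, huN⟩ := hU u hu
    by_contra! hno
    obtain ⟨a, hau, haD, hsa⟩ : ∃ a ≤ u, u ≤ a + D ∧ ∑ n ∈ range a, (c n : ℝ) * x ^ n = 0 := by
      rcases Nat.lt_or_ge u (M * #S) with h | h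
      -- Too close to `0` for a gap to be found on the left; the empty sum serves instead.
      · exact ⟨0, Nat.zero_le _, by omega, by simp⟩
      · obtain ⟨a, h1, h2, h3⟩ := exists_gap S (u - M * #S) M
        refine ⟨a, by omega, by omega, hM a (by omega) fun n hn1 hn2 => ?_⟩
        by_contra hne
        exact h3 n (hS n (by omega) hne) ⟨hn1, hn2⟩
    obtain ⟨b, h1, h2, h3⟩ := exists_gap S (u + 1) M
    have hsb : ∑ n ∈ range b, (c n : ℝ) * x ^ n = 0 := by
      refine hM b (by omega) fun n hn1 hn2 => ?_
      by_contra hne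
      exact h3 n (hS n (by omega) hne) ⟨hn1, hn2⟩
    have hIco : ∑ n ∈ Finset.Ico a b, (c n : ℝ) * x ^ n = 0 := by
      rw [Finset.sum_Ico_eq_sub _ (by omega), hsa, hsb, sub_zero]
    have hIco' : ∑ n ∈ Finset.Ico a b, (c n : ℝ) * x ^ n =
        A * ∑ n ∈ Finset.Ico a b, (ρ n : ℝ) * x ^ n := by
      rw [Finset.mul_sum]
      refine Finset.sum_congr rfl fun n hn => ?_
      obtain ⟨hn1, hn2⟩ := Finset.mem_Ico.1 hn
      rw [hT n (by omega) fun hnT => by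
        have := hno n hnT (by omega)
        omega]
      push_cast
      ring
    rw [hIco'] at hIco
    have hsum := (mul_eq_zero.1 hIco).resolve_left (by exact_mod_cast hA)
    rw [Finset.sum_eq_zero_iff_of_nonneg fun n _ =>
      mul_nonneg (by exact_mod_cast hρ n) (pow_pos hx n).le] at hsum
    have h0 := hsum u (Finset.mem_Ico.2 ⟨hau, by omega⟩)
    have hρu' : (0 : ℝ) < ρ u := by exact_mod_cast hρu
    exact (mul_pos hρu' (pow_pos hx u)).ne' h0
  choose! τ hτT hτ1 hτ2 using hex
  refine Finset.card_le_card_of_injOn τ hτT fun u hu v hv huv => ?_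
  have h1 := hτ1 u hu
  have h2 := hτ2 u hu
  have h3 := hτ1 v hv
  have h4 := hτ2 v hv
  rcases lt_trichotomy u v with h | h | h
  · have := hsep u hu v hv h
    omega
  · exact h
  · have := hsep v hv u hu h
    omega

theorem coeff_aeval_eq_sum (P : MvPolynomial (Set.Ici (1 : ℝ)) ℤ) (n : ℕ) :
    (MvPolynomial.aeval (fun y : Set.Ici (1 : ℝ) => gapSeries (floorGrowth y)) P).coeff n =
      ∑ k ∈ P.support, P.coeff k * (monomialSeries k).coeff n := by
  rw [MvPolynomial.aeval_def, MvPolynomial.eval₂_eq, map_sum]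
  refine Finset.sum_congr rfl fun k _ => ?_
  have : (algebraMap ℤ (PowerSeries ℤ)) (P.coeff k) = PowerSeries.C (P.coeff k) := rfl
  rw [this, PowerSeries.coeff_C_mul]
  rfl

theorem eventually_sum_exp_growthWeight_lt {s : Finset (Set.Ici (1 : ℝ) →₀ ℕ)}
    {g : Set.Ici (1 : ℝ) →₀ ℕ} (hs : ∀ k ∈ s, toLex k < toLex g) (C : ℝ) :
    ∀ᶠ t : ℝ in atTop, ∑ k ∈ s, Real.exp (growthWeight k t + 3 * k.degree) <
      Real.exp (growthWeight g t - C) := by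
  have h : Tendsto (fun t => ∑ k ∈ s, Real.exp (3 * k.degree + C) *
      Real.exp (-(growthWeight g t - growthWeight k t))) atTop (𝓝 (∑ k ∈ s,
        Real.exp (3 * k.degree + C) * 0)) :=
    tendsto_finsetSum _ fun k hk => (Real.tendsto_exp_neg_atTop_nhds_zero.comp
      (tendsto_growthWeight_sub (hs k hk))).const_mul _
  simp only [mul_zero, Finset.sum_const_zero] at h
  filter_upwards [h.eventually (gt_mem_nhds one_pos)] with t ht
  calc _ = (∑ k ∈ s, Real.exp (3 * k.degree + C) *
        Real.exp (-(growthWeight g t - growthWeight k t))) * Real.exp (growthWeight g t - C) := by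
        rw [Finset.sum_mul]
        refine Finset.sum_congr rfl fun k _ => ?_
        rw [← Real.exp_add, ← Real.exp_add]
        ring_nf
    _ < 1 * Real.exp (growthWeight g t - C) := by gcongr
    _ = _ := one_mul _

theorem eventually_sum_exp_growthWeight_le (s : Finset (Set.Ici (1 : ℝ) →₀ ℕ)) :
    ∀ᶠ t : ℝ in atTop, ∑ k ∈ s, Real.exp (growthWeight k t + 3 * k.degree) ≤
      Real.exp (t / 8) := by
  have h1 : ∀ k ∈ s, ∀ᶠ t : ℝ in atTop,
      Real.exp (growthWeight k t + 3 * k.degree) ≤ Real.exp (t / 16) := by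
    intro k _
    filter_upwards [(tendsto_growthWeight_div k).eventually
      (gt_mem_nhds (by norm_num : (0 : ℝ) < 1 / 32)), eventually_ge_atTop (96 * (k.degree : ℝ)),
      eventually_gt_atTop 0] with t ht htk ht0
    rw [div_lt_iff₀ ht0] at ht
    exact Real.exp_le_exp.2 (by linarith)
  have h2 : Tendsto (fun t : ℝ => Real.exp (t / 16)) atTop atTop :=
    Real.tendsto_exp_atTop.comp (tendsto_id.atTop_div_const (by norm_num))
  filter_upwards [(Finset.eventually_all s).2 h1, h2.eventually_ge_atTop (#s : ℝ)] with t ht hs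
  calc _ ≤ ∑ k ∈ s, Real.exp (t / 16) := Finset.sum_le_sum ht
    _ = #s * Real.exp (t / 16) := by simp
    _ ≤ Real.exp (t / 16) * Real.exp (t / 16) := by gcongr
    _ = _ := by rw [← Real.exp_add]; ring_nf

theorem aeval_xiSeries_ne_zero {β : ℝ} (hint : IsIntegral ℤ β) (h1 : 1 < β)
    (hconj : ∀ z : ℂ, Polynomial.aeval z (minpoly ℚ β) = 0 → z ≠ (β : ℂ) → ‖z‖ ≤ 1)
    {P : MvPolynomial (Set.Ici (1 : ℝ)) ℤ} (hP : P ≠ 0) :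
    MvPolynomial.aeval (fun y : Set.Ici (1 : ℝ) => xiSeries (y : ℝ) β⁻¹) P ≠ 0 := by
  classical
  intro hzero
  have hx0 : 0 < β⁻¹ := inv_pos.2 (by linarith)
  have hx1 : β⁻¹ < 1 := inv_lt_one_of_one_lt₀ h1
  obtain ⟨⟨K, E, hbound⟩, hsum⟩ := hasSum_coeff_aeval
    (f := fun y : Set.Ici (1 : ℝ) => gapSeries (floorGrowth y))
    (fun y => polyBounded_gapSeries _) hx0 hx1 (fun y => by
      have hy : (1 : ℝ) ≤ y := y.2
      exact hasSum_gapSeries (self_le_floorGrowth (by linarith))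
        (summable_xiSeries (by linarith) hx0.le hx1)) P
  set c : ℕ → ℤ := fun n =>
    (MvPolynomial.aeval (fun y : Set.Ici (1 : ℝ) => gapSeries (floorGrowth y)) P).coeff n with hc
  have hsum0 : HasSum (fun n => (c n : ℝ) * β⁻¹ ^ n) 0 := by
    rw [← hzero]
    exact hsum
  obtain ⟨g, hg, hmax⟩ := Finset.exists_max_image P.support (fun k => toLex k)
    (MvPolynomial.support_nonempty.2 hP)
  have hlt : ∀ k ∈ P.support.erase g, toLex k < toLex g := fun k hk =>
    lt_of_le_of_ne (hmax k (Finset.mem_of_mem_erase hk))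
      fun h => Finset.ne_of_mem_erase hk (toLex.injective h)
  -- `7 / 8` exceeds `1 / 2 + 1 / 8`: gaps have length about `exp (t / 2)` and there are at most
  -- `exp (t / 8)` exponents, so `D` is far below the separation.
  obtain ⟨C, hrich⟩ := exists_separated_monomialSeries _ g rfl (7 / 8) (by norm_num) (by norm_num)
  have hMt : Tendsto (fun t : ℝ => ⌈Real.exp (t / 2 + 1)⌉₊) atTop atTop :=
    tendsto_nat_ceil_atTop.comp (Real.tendsto_exp_atTop.comp
      (tendsto_atTop_add_const_right _ _ (tendsto_id.atTop_div_const two_pos)))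
  obtain ⟨t, ⟨U, hU1, hU2, hU3⟩, hpart, hTlt, hSle, ht⟩ := (hrich.and
    ((hMt.eventually (eventually_partial_sum_eq_zero hint h1 hconj hbound hsum0)).and
    ((eventually_sum_exp_growthWeight_lt hlt C).and
    ((eventually_sum_exp_growthWeight_le P.support).and (eventually_ge_atTop 64))))).exists
  set N := ⌊Real.exp (t + 2)⌋₊ with hN
  -- Chosen so that `N ≤ M ^ 2`.
  set M := ⌈Real.exp (t / 2 + 1)⌉₊ with hM
  have hNle : (N : ℝ) ≤ Real.exp (t + 2) := Nat.floor_le (Real.exp_pos _).le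
  have hcount := fun k : Set.Ici (1 : ℝ) →₀ ℕ =>
    suppCount_monomialSeries_le k (by linarith : 1 ≤ t) hNle
  set T := (P.support.erase g).biUnion fun k => {n ∈ range N | (monomialSeries k).coeff n ≠ 0}
    with hT
  set S := P.support.biUnion fun k => {n ∈ range N | (monomialSeries k).coeff n ≠ 0} with hS
  have hTcard : (#T : ℝ) < #U := by
    refine lt_of_le_of_lt ?_ (hTlt.trans_le hU3)
    have h2 : (#T : ℝ) ≤ ∑ k ∈ P.support.erase g, (suppCount (monomialSeries k) N : ℝ) := by
      exact_mod_cast Finset.card_biUnion_le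
    exact h2.trans (Finset.sum_le_sum fun k _ => hcount k)
  have hScard : (#S : ℝ) ≤ Real.exp (t / 8) := by
    have h2 : (#S : ℝ) ≤ ∑ k ∈ P.support, (suppCount (monomialSeries k) N : ℝ) := by
      exact_mod_cast Finset.card_biUnion_le
    exact (h2.trans (Finset.sum_le_sum fun k _ => hcount k)).trans hSle
  have hMle : (M : ℝ) ≤ 2 * Real.exp (t / 2 + 1) := by
    have h2 := Nat.ceil_lt_add_one (Real.exp_pos (t / 2 + 1)).le
    have h3 : 1 ≤ Real.exp (t / 2 + 1) := Real.one_le_exp (by linarith)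
    linarith
  have hNM : N ≤ M ^ 2 := by
    have h2 : Real.exp (t + 2) = Real.exp (t / 2 + 1) ^ 2 := by
      rw [← Real.exp_nat_mul]
      push_cast
      ring_nf
    have h3 : (N : ℝ) ≤ (M : ℝ) ^ 2 := by
      rw [h2] at hNle
      refine hNle.trans ?_
      gcongr
      exact Nat.le_ceil _
    exact_mod_cast h3
  have he1 : (2 : ℝ) ≤ Real.exp 1 := by linarith [Real.add_one_le_exp (1 : ℝ)]
  have hDle : ((M * #S + M + 1 : ℕ) : ℝ) ≤ Real.exp (7 / 8 * t) / 4 := by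
    push_cast
    have h2 : 1 ≤ Real.exp (t / 8) := Real.one_le_exp (by linarith)
    have h3 : 1 ≤ Real.exp (t / 2 + 1) := Real.one_le_exp (by linarith)
    have h4 : Real.exp (t / 2 + 1) * Real.exp (t / 8) * Real.exp 5 ≤ Real.exp (7 / 8 * t) := by
      rw [← Real.exp_add, ← Real.exp_add]
      exact Real.exp_le_exp.2 (by linarith)
    have h5 : (32 : ℝ) ≤ Real.exp 5 := by
      have : Real.exp 5 = Real.exp 1 ^ 5 := by
        rw [← Real.exp_nat_mul]
        norm_num
      rw [this]
      calc (32 : ℝ) = 2 ^ 5 := by norm_num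
        _ ≤ _ := by gcongr
    have h6 : 1 ≤ Real.exp (t / 2 + 1) * Real.exp (t / 8) := one_le_mul_of_one_le_of_one_le h3 h2
    have h7 : (M : ℝ) * #S ≤ 2 * Real.exp (t / 2 + 1) * Real.exp (t / 8) := by gcongr
    have h8 : Real.exp (t / 2 + 1) ≤ Real.exp (t / 2 + 1) * Real.exp (t / 8) :=
      le_mul_of_one_le_right (by linarith) h2
    nlinarith
  refine absurd ?_ (not_le.2 (by exact_mod_cast hTcard : #T < #U))
  have hDexp : Real.exp (7 / 8 * t) ≤ Real.exp t := Real.exp_le_exp.2 (by linarith)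
  have hNge : 3 * Real.exp t ≤ N + 1 := by
    have h2 : Real.exp (t + 2) < N + 1 := Nat.lt_floor_add_one _
    have h3 : (3 : ℝ) ≤ Real.exp 2 := by linarith [Real.add_one_le_exp (2 : ℝ)]
    rw [Real.exp_add] at h2
    nlinarith [Real.exp_pos t]
  have hexpt : 1 ≤ Real.exp t := Real.one_le_exp (by linarith)
  refine card_le_of_partial_sum_eq_zero (c := c) (ρ := fun n => (monomialSeries g).coeff n)
    (MvPolynomial.mem_support_iff.1 hg) (coeff_monomialSeries_nonneg g) hx0 (N := N) (M := M)
    (S := S) (D := M * #S + M + 1) (fun R hR => hpart R (hR.trans hNM)) ?_ ?_ le_rfl ?_ ?_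
  · intro n hn hnT
    rw [hc]
    simp only
    rw [coeff_aeval_eq_sum]
    refine Finset.sum_eq_single_of_mem g hg fun k hk hkg => ?_
    by_contra hne
    exact hnT (Finset.mem_biUnion.2 ⟨k, Finset.mem_erase.2 ⟨hkg, hk⟩,
      Finset.mem_filter.2 ⟨Finset.mem_range.2 hn, right_ne_zero_of_mul hne⟩⟩)
  · intro n hn hne
    rw [hc] at hne
    simp only at hne
    rw [coeff_aeval_eq_sum] at hne
    obtain ⟨k, hk, hk'⟩ := Finset.exists_ne_zero_of_sum_ne_zero hne
    exact Finset.mem_biUnion.2 ⟨k, hk,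
      Finset.mem_filter.2 ⟨Finset.mem_range.2 hn, right_ne_zero_of_mul hk'⟩⟩
  · intro u hu
    refine ⟨(hU1 u hu).1, ?_⟩
    have h2 : ((u + (M * #S + M + 1) : ℕ) : ℝ) ≤ N := by
      rw [Nat.cast_add]
      linarith [(hU1 u hu).2]
    exact_mod_cast h2
  · intro u hu v hv huv
    have h2 : ((u + 2 * (M * #S + M + 1) : ℕ) : ℝ) < v := by
      rw [Nat.cast_add, Nat.cast_mul, Nat.cast_ofNat]
      linarith [hU2 u hu v hv huv, Real.exp_pos (7 / 8 * t)]
    exact_mod_cast h2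

end

theorem mainTheorem2 (β : ℝ) (hβ : IsPisotNumber β ∨ IsSalemNumber β) :
    AlgebraicIndependent ℚ (fun y : Set.Ici (1 : ℝ) => xiSeries (y : ℝ) β⁻¹) := by
  obtain ⟨hint, h1, hconj⟩ : IsIntegral ℤ β ∧ 1 < β ∧
      ∀ z : ℂ, Polynomial.aeval z (minpoly ℚ β) = 0 → z ≠ (β : ℂ) → ‖z‖ ≤ 1 := by
    rcases hβ with ⟨h, h1, hc⟩ | ⟨h, h1, hc, _⟩
    · exact ⟨h, h1, fun z hz hne => (hc z hz hne).le⟩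
    · exact ⟨h, h1, hc⟩
  have hZ : AlgebraicIndependent ℤ (fun y : Set.Ici (1 : ℝ) => xiSeries (y : ℝ) β⁻¹) := by
    rw [algebraicIndependent_iff]
    intro P hP
    by_contra hne
    exact aeval_xiSeries_ne_zero hint h1 hconj hne hP
  -- Independence passes from `ℤ` to its algebraic extension `ℚ`.
  have : Algebra.IsAlgebraic ℤ ℚ := IsLocalization.isAlgebraic ℚ (nonZeroDivisors ℤ)
  exact hZ.extendScalars ℚ
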